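/- Fix $m \geq 2$ and a set $S = \{s_1 < \dots < s_i\} \subseteq \{1, 2, \dots, m-1\}$ with $1 \in S$, and put $s_{i+1} = m$. A partition $\lambda$ is a weakly decreasing sequence $\lambda_1 \geq \lambda_2 \geq \dots \geq \lambda_\ell$ of positive integers (its parts), with $\lambda_k = 0$ for $k > \ell$. A colored partition of $n$ is a finite multiset of pairs (part, color), the parts being positive integers with sum $n$. Let $n \geq 1$, let $\rho_1, \dots, \rho_{m-1} \geq 0$ be integers, let $t \geq 0$, let $\alpha_1, \dots, \alpha_t$ be distinct positive integers, and let $p_1, \dots, p_t \geq m$ be integers. Then the following two sets are equinumerous. (a) The partitions $\lambda$ such that $$n = \sum_{\substack{k \geq 1 \\ k \equiv s \ (\mathrm{mod}\ m) \text{ for some } s \in S}} \lambda_k, \qquad \rho_j = \sum_{k \geq 0} (\lambda_{mk+j} - \lambda_{mk+j+1}) \quad (1 \leq j < m),$$ the integers that occur at least $m$ times as a part of $\lambda$ are exactly $\alpha_1, \dots, \alpha_t$, and for each $r$ the multiplicity $p$ of $\alpha_r$ in $\lambda$ satisfies $\lfloor p/m \rfloor = \lfloor p_r/m \rfloor$.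 (b) The colored partitions of $n$ with colors in $\{1, \dots, m\}$ such that: every part with a color other than $m$ that is congruent to $k$ modulo $i$, where $1 \leq k \leq i$, has one of the $s_{k+1} - s_k$ colors $s_k, \dots, s_{k+1} - 1$; for each $1 \leq j < m$, exactly $\rho_j$ parts have color $j$; and the parts of color $m$ are exactly $i\alpha_1, \dots, i\alpha_t$, where $i\alpha_r$ appears in color $m$ exactly $\lfloor p_r/m \rfloor$ times for each $r$. -/

import Mathlib

/-- The set of all integer partitions, of every size. -/
abbrev AllPartitions : Type := Σ N : ℕ, N.Partition

namespace AllPartitions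

/-- The parts of a partition as a weakly decreasing list. -/
def toList (P : AllPartitions) : List ℕ := P.2.parts.sort (fun a b => b ≤ a)

/-- The number of parts. -/
def length (P : AllPartitions) : ℕ := P.toList.length

/-- The `k`-th largest part (indices start at `1`), which is `0` beyond the length.
Only used for `k ≥ 1`. -/
def part (P : AllPartitions) (k : ℕ) : ℕ := P.toList.getD (k - 1) 0

/-- The Schmidt weight: the sum of the parts whose index `k ≥ 1` is congruent modulo `m` to an
element of `S`. -/
def schmidtWeight (m : ℕ) (S : Finset ℕ) (P : AllPartitions) : ℕ :=
  ∑ k ∈ (Finset.Icc 1 P.length).filter (fun k => ∃ s ∈ S, k ≡ s [MOD m]), P.part k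

/-- The alternating sum over `k ≥ 0` of `P_{mk+j} - P_{mk+j+1}`. For `m, j ≥ 1` all the terms with
`k ≥ P.length` are zero, hence the finite range. -/
def altSum (m j : ℕ) (P : AllPartitions) : ℤ :=
  ∑ k ∈ Finset.range P.length, ((P.part (m * k + j) : ℤ) - (P.part (m * k + j + 1) : ℤ))

end AllPartitions

/-- A colored partition of `n`: a finite multiset of pairs (part size, color) with positive part
sizes adding up to `n`. -/
structure ColoredPartition (n : ℕ) where
  parts : Multiset (ℕ × ℕ)
  parts_pos : ∀ x ∈ parts, 0 < x.1
  parts_sum : (parts.map Prod.fst).sum = n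

/-- The number of parts of color `c`. -/
def ColoredPartition.colorCount {n : ℕ} (Q : ColoredPartition n) (c : ℕ) : ℕ :=
  Q.parts.countP (fun x => x.2 = c)

/-- For `S = {s_1 < ... < s_i}`, the element `s_k` for `1 ≤ k ≤ i`, with `s_{i+1} = m`. -/
def colorBound (m : ℕ) (S : Finset ℕ) (k : ℕ) : ℕ := (S.sort (fun a b => a ≤ b)).getD (k - 1) m

/-- A part of size `a` may have the color `c`: writing `S = {s_1 < ... < s_i}` and `s_{i+1} = m`,
there is `1 ≤ k ≤ i` with `a ≡ k` modulo `i` and `c ∈ {s_k, ..., s_{k+1} - 1}`. -/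
def AllowedColor (m : ℕ) (S : Finset ℕ) (a c : ℕ) : Prop :=
  ∃ k ∈ Finset.Icc 1 S.card, a ≡ k [MOD S.card] ∧
    c ∈ Finset.Ico (colorBound m S k) (colorBound m S (k + 1))

/-! ### Row and column lengths of Young diagrams -/

namespace YoungDiagram

/-! Conjugate the partition. A conjugate part v contributes `schmidtCount m S v` to the Schmidt
weight, and the j-th alternating sum counts the conjugate parts congruent to j modulo m. Coloring a
part v of N by `colorPart` turns these statistics into size and colors, the multiples m * a becoming
the parts i * a of color m, where i is the cardinality of S.

The repetition condition concerns the partition M, not its conjugate. Dividing multiplicities by m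
writes M uniquely as R + m • Q with R `Flat`. Likewise N is uniquely a `Regular` multiset Y together
with the m-fold multiples of some Q. Since schmidtCount(m q + r) = i q + schmidtCount(r), in both
cases Q adds i * Q.sum to the weight and leaves the residue counts unchanged
(`weight_conj_addNsmul`, `weight_addMap`).

So Flat × Q and Regular × Q have the same refined enumerator, that of all multisets. Cancelling the
common factor (`nonempty_fiber_equiv_of_prod`) makes R and Y equinumerous in each weight with given
residues. Restoring one fixed Q, which records both the floors of p_r / m and the color-m parts,
gives the theorem. The cancellation compares finite cardinalities and constructs no explicit
bijection. -/

theorem getD_rowLens (μ : YoungDiagram) (k : ℕ) : μ.rowLens.getD k 0 = μ.rowLen k := by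
  by_cases h : k < μ.rowLens.length
  · rw [List.getD_eq_getElem _ _ h]
    exact μ.get_rowLens
  · rw [List.getD_eq_default _ _ (not_lt.mp h)]
    rw [length_rowLens] at h
    by_contra h0
    exact h (mem_iff_lt_colLen.mp (mem_iff_lt_rowLen.mpr (Nat.pos_of_ne_zero (Ne.symm h0))))

theorem countP_rowLens (μ : YoungDiagram) (x : ℕ) :
    (μ.rowLens : Multiset ℕ).countP (x < ·) = μ.colLen x := by
  have h : (μ.rowLens : Multiset ℕ) = (Finset.range (μ.colLen 0)).val.map μ.rowLen := rfl
  rw [h, Multiset.countP_map, ← Finset.filter_val, Finset.card_val]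
  have : (Finset.range (μ.colLen 0)).filter (fun i => x < μ.rowLen i)
      = Finset.range (μ.colLen x) := by
    ext i
    simp only [Finset.mem_filter, Finset.mem_range, ← mem_iff_lt_rowLen, ← mem_iff_lt_colLen]
    exact ⟨fun h => h.2, fun h => ⟨μ.up_left_mem le_rfl (Nat.zero_le _) h, h⟩⟩
  rw [this, Finset.card_range]

theorem sum_map_rowLens_transpose (μ : YoungDiagram) {φ : ℕ → ℕ} (hφ : φ 0 = 0) {B : ℕ}
    (hB : μ.rowLen 0 ≤ B) :
    ((μ.transpose.rowLens : Multiset ℕ).map φ).sum = ∑ x ∈ Finset.range B, φ (μ.colLen x) := by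
  have h : (μ.transpose.rowLens : Multiset ℕ)
      = (Finset.range (μ.transpose.colLen 0)).val.map μ.transpose.rowLen := rfl
  rw [h, Multiset.map_map, colLen_transpose]
  change ∑ x ∈ Finset.range (μ.rowLen 0), φ (μ.transpose.rowLen x) = _
  simp only [rowLen_transpose]
  refine Finset.sum_subset (Finset.range_mono hB) fun x _ hx => ?_
  rw [Finset.mem_range, ← mem_iff_lt_rowLen, mem_iff_lt_colLen, Nat.pos_iff_ne_zero, not_not] at hx
  rw [hx, hφ]

end YoungDiagram

/-! ### Multisets of positive integers and conjugation -/

/-- The finite multisets of positive integers. -/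
abbrev PosMultiset : Type := {M : Multiset ℕ // ∀ x ∈ M, 0 < x}

namespace PosMultiset

/-- Multisets of positive integers as Young diagrams, through the row lengths. -/
def young : YoungDiagram ≃ PosMultiset :=
  YoungDiagram.equivListRowLens.trans
    { toFun := fun l => ⟨(l.1 : Multiset ℕ), fun x hx => l.2.2 x hx⟩
      invFun := fun M => ⟨M.1.sort (fun a b => b ≤ a),
        (M.1.pairwise_sort (fun a b => b ≤ a)).sortedGE, fun x hx => M.2 x (by simpa using hx)⟩
      left_inv := fun l => Subtype.ext (by
        have := l.2.1.pairwise
        simpa using List.mergeSort_eq_self (fun a b : ℕ => b ≤ a) this)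
      right_inv := fun M => Subtype.ext (by simp) }

theorem coe_young (μ : YoungDiagram) : (young μ).1 = (μ.rowLens : Multiset ℕ) := rfl

theorem sort_young (μ : YoungDiagram) :
    (young μ).1.sort (fun a b => b ≤ a) = μ.rowLens :=
  List.mergeSort_eq_self (fun a b : ℕ => b ≤ a) μ.rowLens_sorted.pairwise

/-- Conjugation. -/
def conj : PosMultiset ≃ PosMultiset :=
  (young.symm.trans YoungDiagram.transposeOrderIso.toEquiv).trans young

theorem conj_young (μ : YoungDiagram) : conj (young μ) = young μ.transpose := by
  simp [conj]

theorem countP_conj (M : PosMultiset) (k : ℕ) :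
    (conj M).1.countP (k < ·) = (M.1.sort (fun a b => b ≤ a)).getD k 0 := by
  obtain ⟨μ, rfl⟩ := young.surjective M
  rw [conj_young, sort_young, coe_young, YoungDiagram.countP_rowLens,
    YoungDiagram.getD_rowLens, YoungDiagram.colLen_transpose]

theorem sum_map_conj (M : PosMultiset) {φ : ℕ → ℕ} (hφ : φ 0 = 0) {B : ℕ}
    (hB : ∀ x ∈ M.1, x ≤ B) :
    ((conj M).1.map φ).sum = ∑ x ∈ Finset.range B, φ (M.1.countP (x < ·)) := by
  obtain ⟨μ, rfl⟩ := young.surjective M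
  have hB' : μ.rowLen 0 ≤ B := by
    by_contra h
    rw [not_le] at h
    refine (hB (μ.rowLen 0) ?_).not_gt h
    rw [coe_young, Multiset.mem_coe]
    have h0 : 0 < μ.colLen 0 :=
      YoungDiagram.mem_iff_lt_colLen.mp
        (YoungDiagram.mem_iff_lt_rowLen.mpr ((Nat.zero_le _).trans_lt h))
    exact List.mem_map.mpr ⟨0, List.mem_range.mpr h0, rfl⟩
  rw [conj_young, coe_young, YoungDiagram.sum_map_rowLens_transpose μ hφ hB']
  simp only [coe_young, YoungDiagram.countP_rowLens]

/-- Weighting the sorted parts by `f` amounts to weighting the conjugate parts by the partial sums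
of `f`. -/
theorem sum_sort_mul (M : PosMultiset) (f : ℕ → ℤ) {N : ℕ} (hN : M.1.card ≤ N) :
    ∑ k ∈ Finset.range N, f k * ((M.1.sort (fun a b => b ≤ a)).getD k 0 : ℕ)
      = ((conj M).1.map fun v => ∑ k ∈ Finset.range v, f k).sum := by
  have hle : ∀ v ∈ (conj M).1, v ≤ N := by
    intro v hv
    by_contra h
    have h0 : 0 < (conj M).1.countP (N < ·) :=
      Multiset.countP_pos.mpr ⟨v, hv, not_le.mp h⟩
    rw [countP_conj, List.getD_eq_default _ _ (by simpa using hN)] at h0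
    exact h0.false
  simp only [← countP_conj]
  generalize (conj M).1 = C at hle
  induction C using Multiset.induction with
  | empty => simp
  | cons v C ih =>
    rw [Multiset.map_cons, Multiset.sum_cons, ← ih fun x hx => hle x (Multiset.mem_cons_of_mem hx)]
    simp only [Multiset.countP_cons, Nat.cast_add, mul_add, Finset.sum_add_distrib]
    rw [add_comm]
    congr 1
    simp only [Nat.cast_ite, Nat.cast_one, Nat.cast_zero, mul_ite, mul_one, mul_zero]
    rw [← Finset.sum_filter]
    congr 1
    ext k
    have := hle v (Multiset.mem_cons_self _ _)
    simp only [Finset.mem_filter, Finset.mem_range]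
    omega

end PosMultiset

/-! ### Statistics of a partition read on its conjugate -/

/-- The number of indices `1 ≤ k ≤ v` that are congruent modulo `m` to an element of `S`. -/
def schmidtCount (m : ℕ) (S : Finset ℕ) (v : ℕ) : ℕ :=
  ((Finset.Icc 1 v).filter (fun k => ∃ s ∈ S, k ≡ s [MOD m])).card

theorem schmidtCount_zero (m : ℕ) (S : Finset ℕ) : schmidtCount m S 0 = 0 := by
  simp [schmidtCount]

theorem sum_range_ite_modEq (m : ℕ) (S : Finset ℕ) (v : ℕ) :
    ∑ k ∈ Finset.range v, (if ∃ s ∈ S, k + 1 ≡ s [MOD m] then (1 : ℤ) else 0)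
      = schmidtCount m S v := by
  rw [schmidtCount, Finset.card_filter, ← Finset.Ico_add_one_right_eq_Icc,
    Finset.sum_Ico_eq_sum_range]
  push_cast
  simp only [add_comm 1]

/-- Forgetting the size of a partition. -/
def AllPartitions.equivPosMultiset : AllPartitions ≃ PosMultiset where
  toFun P := ⟨P.2.parts, fun _ hx => P.2.parts_pos hx⟩
  invFun M := ⟨M.1.sum, ⟨M.1, fun {_} hx => M.2 _ hx, rfl⟩⟩
  left_inv P := by
    obtain ⟨N, ⟨parts, hpos, hsum⟩⟩ := P
    subst hsum
    rfl
  right_inv _ := rfl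

namespace PosMultiset

/-- The total weight of the parts for the weight function `schmidtCount`. -/
def weight (m : ℕ) (S : Finset ℕ) (M : PosMultiset) : ℕ := (M.1.map (schmidtCount m S)).sum

/-- The numbers of parts in the nonzero residue classes modulo `m` are given by `ρ`. -/
def HasResidues (m : ℕ) (ρ : ℕ → ℕ) (M : PosMultiset) : Prop :=
  ∀ j ∈ Finset.Ico 1 m, M.1.countP (fun v => v % m = j) = ρ j

end PosMultiset

open PosMultiset

theorem AllPartitions.schmidtWeight_eq (m : ℕ) (S : Finset ℕ) (P : AllPartitions) :
    P.schmidtWeight m S = (conj (equivPosMultiset P)).weight m S := by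
  have h := sum_sort_mul (equivPosMultiset P)
    (fun k => if ∃ s ∈ S, k + 1 ≡ s [MOD m] then (1 : ℤ) else 0) (N := P.length)
    (by simp [AllPartitions.length, AllPartitions.toList, equivPosMultiset])
  simp only [sum_range_ite_modEq] at h
  have h2 : ((conj (equivPosMultiset P)).1.map fun v => (schmidtCount m S v : ℤ)).sum
      = (((conj (equivPosMultiset P)).weight m S : ℕ) : ℤ) := by
    rw [weight, Nat.cast_multiset_sum, Multiset.map_map]
    rfl
  rw [h2] at h
  zify
  rw [← h, schmidtWeight, Finset.sum_filter, ← Finset.Ico_add_one_right_eq_Icc,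
    Finset.sum_Ico_eq_sum_range]
  push_cast
  simp only [add_comm 1, ite_mul, one_mul, zero_mul]
  rfl

theorem AllPartitions.altSum_eq {m j : ℕ} (hm : 2 ≤ m) (hj : j ∈ Finset.Ico 1 m)
    (P : AllPartitions) :
    P.altSum m j = ((conj (equivPosMultiset P)).1.countP (fun v => v % m = j) : ℕ) := by
  rw [Finset.mem_Ico] at hj
  have hpart : ∀ k, P.part (k + 1) = (conj (equivPosMultiset P)).1.countP (k < ·) :=
    fun k => (countP_conj (equivPosMultiset P) k).symm
  have hle : ∀ v ∈ (conj (equivPosMultiset P)).1, v ≤ P.length := by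
    intro v hv
    by_contra h
    have h0 : 0 < (conj (equivPosMultiset P)).1.countP (P.length < ·) :=
      Multiset.countP_pos.mpr ⟨v, hv, not_le.mp h⟩
    rw [← hpart, AllPartitions.part, List.getD_eq_default _ _ (by
      rw [add_tsub_cancel_right, AllPartitions.length])] at h0
    exact h0.false
  rw [AllPartitions.altSum]
  have hterm : ∀ k, P.part (m * k + j)
      = (conj (equivPosMultiset P)).1.countP (m * k + j - 1 < ·) := by
    intro k
    rw [← hpart]
    congr 1
    omega
  simp only [hpart, hterm]
  generalize (conj (equivPosMultiset P)).1 = C at hle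
  induction C using Multiset.induction with
  | empty => simp
  | cons v C ih =>
    have hv := hle v (Multiset.mem_cons_self _ _)
    simp only [Multiset.countP_cons]
    push_cast
    rw [← ih fun x hx => hle x (Multiset.mem_cons_of_mem hx)]
    simp only [add_sub_add_comm, Finset.sum_add_distrib]
    congr 1
    -- As j ≥ 1 the subtraction does not truncate: the terms test v ≥ mk + j and v > mk + j.
    have hsplit : ∀ k, ((if m * k + j - 1 < v then (1 : ℤ) else 0) - if m * k + j < v then 1 else 0)
        = if v = m * k + j then 1 else 0 := by
      intro k
      split_ifs <;> omega
    simp only [hsplit]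
    by_cases hvj : v % m = j
    · rw [if_pos hvj, Finset.sum_eq_single (v / m)]
      · rw [if_pos]
        rw [← hvj]
        exact (Nat.div_add_mod v m).symm
      · intro k _ hk
        refine if_neg fun h => hk ?_
        rw [h, Nat.mul_add_div (by omega), Nat.div_eq_of_lt hj.2, add_zero]
      · intro h
        rw [Finset.mem_range, not_lt] at h
        have : 0 < v := Nat.pos_of_ne_zero fun h0 => by
          rw [h0, Nat.zero_mod] at hvj
          omega
        have := Nat.div_lt_self this hm
        omega
    · rw [if_neg hvj]
      refine Finset.sum_eq_zero fun k _ => if_neg fun h => hvj ?_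
      rw [h, Nat.mul_add_mod, Nat.mod_eq_of_lt hj.2]

/-! ### Quasi-periodicity of the counting function -/

theorem periodic_modEq_mem (m : ℕ) (S : Finset ℕ) :
    Function.Periodic (fun k => ∃ s ∈ S, k ≡ s [MOD m]) m := by
  intro k
  simp [Nat.ModEq]

theorem schmidtCount_eq_card {m : ℕ} {S : Finset ℕ} (hS : S ⊆ Finset.Icc 1 (m - 1)) {r : ℕ}
    (hr : r < m) : schmidtCount m S r = (S.filter (· ≤ r)).card := by
  rw [schmidtCount]
  congr 1
  ext k
  simp only [Finset.mem_filter, Finset.mem_Icc]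
  constructor
  · rintro ⟨hk, s, hs, hks⟩
    have := Finset.mem_Icc.mp (hS hs)
    rw [Nat.ModEq, Nat.mod_eq_of_lt (by omega), Nat.mod_eq_of_lt (by omega)] at hks
    exact ⟨hks ▸ hs, hk.2⟩
  · rintro ⟨hs, hk⟩
    have := Finset.mem_Icc.mp (hS hs)
    exact ⟨⟨this.1, hk⟩, k, hs, rfl⟩

theorem schmidtCount_add_self {m : ℕ} (hm : 2 ≤ m) {S : Finset ℕ} (hS : S ⊆ Finset.Icc 1 (m - 1))
    (v : ℕ) : schmidtCount m S (v + m) = schmidtCount m S v + S.card := by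
  have hper := periodic_modEq_mem m S
  have h1 := Nat.filter_Ico_card_eq_of_periodic (v + 1) m _ hper
  have h2 := Nat.filter_Ico_card_eq_of_periodic 1 m _ hper
  have h3 : schmidtCount m S m = S.card := by
    obtain ⟨l, rfl⟩ : ∃ l, m = l + 1 := ⟨m - 1, by omega⟩
    have hl := schmidtCount_eq_card hS (r := l) (by omega)
    rw [Finset.filter_true_of_mem fun s hs => by
      have := Finset.mem_Icc.mp (hS hs)
      omega] at hl
    rw [← hl, schmidtCount, schmidtCount]
    congr 1
    ext k
    simp only [Finset.mem_filter, Finset.mem_Icc]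
    refine and_congr_left fun ⟨s, hs, hks⟩ => ⟨fun hk => ⟨hk.1, ?_⟩, fun hk => ⟨hk.1, by omega⟩⟩
    by_contra h
    obtain rfl : k = l + 1 := by omega
    have := Finset.mem_Icc.mp (hS hs)
    rw [Nat.ModEq, Nat.mod_self, Nat.mod_eq_of_lt (by omega)] at hks
    omega
  have h4 : schmidtCount m S m = m.count fun k => ∃ s ∈ S, k ≡ s [MOD m] := by
    rw [← h2, schmidtCount, ← Finset.Ico_add_one_right_eq_Icc, add_comm]
  rw [← h3, h4, ← h1, schmidtCount, schmidtCount, ← Finset.Ico_add_one_right_eq_Icc,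
    ← Finset.Ico_add_one_right_eq_Icc,
    ← Finset.Ico_union_Ico_eq_Ico (by omega : 1 ≤ v + 1) (by omega : v + 1 ≤ v + m + 1),
    Finset.filter_union, Finset.card_union_of_disjoint, add_right_comm]
  exact Finset.disjoint_filter_filter (Finset.Ico_disjoint_Ico_consecutive _ _ _)

theorem schmidtCount_mul_add {m : ℕ} (hm : 2 ≤ m) {S : Finset ℕ} (hS : S ⊆ Finset.Icc 1 (m - 1))
    (q r : ℕ) : schmidtCount m S (m * q + r) = S.card * q + schmidtCount m S r := by
  induction q with
  | zero => simp
  | succ q ih => rw [mul_add_one, add_right_comm, schmidtCount_add_self hm hS, ih]; ring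

theorem schmidtCount_mul {m : ℕ} (hm : 2 ≤ m) {S : Finset ℕ} (hS : S ⊆ Finset.Icc 1 (m - 1))
    (q : ℕ) : schmidtCount m S (m * q) = S.card * q := by
  simpa [schmidtCount_zero] using schmidtCount_mul_add hm hS q 0

/-- Since 1 ∈ S, every block of m indices, even an incomplete nonempty one, contains a counted
index. This bound makes the weight fibers finite. -/
theorem le_mul_schmidtCount {m : ℕ} (hm : 2 ≤ m) {S : Finset ℕ} (hS : S ⊆ Finset.Icc 1 (m - 1))
    (h1S : 1 ∈ S) (v : ℕ) : v ≤ m * schmidtCount m S v := by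
  have hcard : 1 ≤ S.card := Finset.card_pos.mpr ⟨1, h1S⟩
  have hr : v % m < m := Nat.mod_lt _ (by omega)
  have hv : schmidtCount m S v = S.card * (v / m) + schmidtCount m S (v % m) := by
    rw [← schmidtCount_mul_add hm hS, Nat.div_add_mod]
  have h1 : v / m ≤ S.card * (v / m) := Nat.le_mul_of_pos_left _ hcard
  have h2 : v % m ≤ m * schmidtCount m S (v % m) := by
    rcases Nat.eq_zero_or_pos (v % m) with h | h
    · rw [h]; exact Nat.zero_le _
    · refine hr.le.trans (Nat.le_mul_of_pos_right _ ?_)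
      rw [schmidtCount_eq_card hS hr]
      exact Finset.card_pos.mpr ⟨1, Finset.mem_filter.mpr ⟨h1S, h⟩⟩
  calc v = m * (v / m) + v % m := (Nat.div_add_mod v m).symm
    _ ≤ m * (S.card * (v / m)) + m * schmidtCount m S (v % m) := by gcongr
    _ = m * schmidtCount m S v := by rw [hv, mul_add]

theorem Multiset.sum_range_countP_lt {Q : Multiset ℕ} {B : ℕ} (hB : ∀ x ∈ Q, x ≤ B) :
    ∑ x ∈ Finset.range B, Q.countP (x < ·) = Q.sum := by
  induction Q using Multiset.induction with
  | empty => simp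
  | cons a Q ih =>
    have ha := hB a (Multiset.mem_cons_self _ _)
    simp only [Multiset.countP_cons, Finset.sum_add_distrib, Multiset.sum_cons]
    rw [ih fun x hx => hB x (Multiset.mem_cons_of_mem hx), add_comm, ← Finset.card_filter]
    have : (Finset.range B).filter (· < a) = Finset.range a := by
      ext k
      simp only [Finset.mem_filter, Finset.mem_range]
      omega
    rw [this, Finset.card_range]

/-! ### Two decompositions with a common free factor -/

namespace PosMultiset

/-- The multisets in which every multiplicity is less than `m`. -/
abbrev Flat (m : ℕ) : Type := {M : PosMultiset // ∀ a, M.1.count a < m}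

/-- The multisets without a multiple of `m`. -/
abbrev Regular (m : ℕ) : Type := {M : PosMultiset // ∀ a ∈ M.1, ¬ m ∣ a}

/-- Add `m` copies of the second multiset to the first. -/
def addNsmul {m : ℕ} (p : Flat m × PosMultiset) : PosMultiset :=
  ⟨p.1.1.1 + m • p.2.1, fun x hx => (Multiset.mem_add.mp hx).elim (p.1.1.2 x)
    fun h => p.2.2 x (Multiset.mem_of_mem_nsmul h)⟩

theorem count_addNsmul_div {m : ℕ} (p : Flat m × PosMultiset) (a : ℕ) :
    (addNsmul p).1.count a / m = p.2.1.count a := by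
  have := p.1.2 a
  rw [addNsmul, Multiset.count_add, Multiset.count_nsmul, Nat.add_mul_div_left _ _ (by omega),
    Nat.div_eq_of_lt this, zero_add]

theorem count_addNsmul_mod {m : ℕ} (p : Flat m × PosMultiset) (a : ℕ) :
    (addNsmul p).1.count a % m = p.1.1.1.count a := by
  have := p.1.2 a
  rw [addNsmul, Multiset.count_add, Multiset.count_nsmul, Nat.add_mul_mod_self_left,
    Nat.mod_eq_of_lt this]

theorem exists_count_eq (M : Multiset ℕ) (f : ℕ → ℕ) (hf : f 0 = 0) :
    ∃ N : Multiset ℕ, ∀ a, N.count a = f (M.count a) := by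
  refine ⟨Finsupp.toMultiset (Finsupp.mapRange f hf (Multiset.toFinsupp M)), fun a => ?_⟩
  simp [Finsupp.count_toMultiset]

/-- Euclidean division by m of each multiplicity. -/
theorem addNsmul_bijective {m : ℕ} (hm : 2 ≤ m) :
    Function.Bijective (addNsmul : Flat m × PosMultiset → PosMultiset) := by
  constructor
  · intro p q h
    refine Prod.ext (Subtype.ext (Subtype.ext (Multiset.ext' fun a => ?_)))
      (Subtype.ext (Multiset.ext' fun a => ?_))
    · rw [← count_addNsmul_mod p, ← count_addNsmul_mod q, h]
    · rw [← count_addNsmul_div p, ← count_addNsmul_div q, h]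
  · intro M
    obtain ⟨R, hR⟩ := exists_count_eq M.1 (· % m) (Nat.zero_mod m)
    obtain ⟨Q, hQ⟩ := exists_count_eq M.1 (· / m) (Nat.zero_div m)
    have hpos : ∀ a, M.1.count a ≠ 0 → 0 < a := fun a h =>
      M.2 a (Multiset.count_ne_zero.mp h)
    refine ⟨⟨⟨⟨R, fun a ha => hpos a fun h => ?_⟩, fun a => ?_⟩, ⟨Q, fun a ha => hpos a fun h => ?_⟩⟩,
      Subtype.ext (Multiset.ext' fun a => ?_)⟩
    · exact Multiset.count_ne_zero.mpr ha (by rw [hR, h, Nat.zero_mod])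
    · rw [hR]
      exact Nat.mod_lt _ (by omega)
    · exact Multiset.count_ne_zero.mpr ha (by rw [hQ, h, Nat.zero_div])
    · rw [addNsmul, Multiset.count_add, Multiset.count_nsmul, hR, hQ, Nat.mod_add_div]

/-- Column lengths add: if Q and R have columns of lengths q and r at x, their combination has m q +
r there. Used with φ = `schmidtCount m S` and, for c = 0, with indicators of residue classes. -/
theorem sum_map_conj_addNsmul {m c : ℕ} {φ : ℕ → ℕ} (h0 : φ 0 = 0)
    (hφ : ∀ q r, φ (m * q + r) = c * q + φ r) (p : Flat m × PosMultiset) :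
    ((conj (addNsmul p)).1.map φ).sum = ((conj p.1.1).1.map φ).sum + c * p.2.1.sum := by
  have hR : ∀ x ∈ p.1.1.1, x ≤ p.1.1.1.sum + p.2.1.sum := fun x hx =>
    (Multiset.le_sum_of_mem hx).trans (Nat.le_add_right _ _)
  have hQ : ∀ x ∈ p.2.1, x ≤ p.1.1.1.sum + p.2.1.sum := fun x hx =>
    (Multiset.le_sum_of_mem hx).trans (Nat.le_add_left _ _)
  have hM : ∀ x ∈ (addNsmul p).1, x ≤ p.1.1.1.sum + p.2.1.sum := fun x hx =>
    (Multiset.mem_add.mp hx).elim (hR x) fun h => hQ x (Multiset.mem_of_mem_nsmul h)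
  generalize p.1.1.1.sum + p.2.1.sum = B at hR hQ hM
  rw [sum_map_conj _ h0 hM, sum_map_conj _ h0 hR, ← Multiset.sum_range_countP_lt hQ,
    Finset.mul_sum, ← Finset.sum_add_distrib]
  refine Finset.sum_congr rfl fun x _ => ?_
  rw [addNsmul, Multiset.countP_add, Multiset.countP_nsmul, add_comm, hφ, add_comm]

theorem weight_conj_addNsmul {m : ℕ} (hm : 2 ≤ m) {S : Finset ℕ} (hS : S ⊆ Finset.Icc 1 (m - 1))
    (p : Flat m × PosMultiset) :
    (conj (addNsmul p)).weight m S = (conj p.1.1).weight m S + S.card * p.2.1.sum :=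
  sum_map_conj_addNsmul (schmidtCount_zero m S) (schmidtCount_mul_add hm hS) p

theorem countP_eq_sum_map (C : Multiset ℕ) (P : ℕ → Prop) [DecidablePred P] :
    C.countP P = (C.map fun v => if P v then 1 else 0).sum := by
  induction C using Multiset.induction with
  | empty => simp
  | cons v C ih => rw [Multiset.countP_cons, ih, Multiset.map_cons, Multiset.sum_cons, add_comm]

theorem hasResidues_conj_addNsmul {m : ℕ} {ρ : ℕ → ℕ} (p : Flat m × PosMultiset) :
    (conj (addNsmul p)).HasResidues m ρ ↔ (conj p.1.1).HasResidues m ρ := by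
  refine forall₂_congr fun j hj => ?_
  rw [Finset.mem_Ico] at hj
  rw [countP_eq_sum_map, countP_eq_sum_map, sum_map_conj_addNsmul (c := 0), zero_mul, add_zero]
  · rw [Nat.zero_mod, if_neg (by omega)]
  · intro q r
    simp

/-- Add the `m`-fold multiples of the elements of the second multiset to the first. -/
def addMap {m : ℕ} (hm : 2 ≤ m) (p : Regular m × PosMultiset) : PosMultiset :=
  ⟨p.1.1.1 + p.2.1.map (m * ·), fun x hx => (Multiset.mem_add.mp hx).elim (p.1.1.2 x) fun h => by
    obtain ⟨a, ha, rfl⟩ := Multiset.mem_map.mp h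
    exact Nat.mul_pos (by omega) (p.2.2 a ha)⟩

theorem filter_not_dvd_addMap {m : ℕ} (hm : 2 ≤ m) (p : Regular m × PosMultiset) :
    (addMap hm p).1.filter (fun x => ¬ m ∣ x) = p.1.1.1 := by
  rw [addMap, Multiset.filter_add, Multiset.filter_eq_self.mpr p.1.2,
    Multiset.filter_eq_nil.mpr, add_zero]
  intro x hx
  obtain ⟨a, _, rfl⟩ := Multiset.mem_map.mp hx
  simp

theorem count_addMap {m : ℕ} (hm : 2 ≤ m) (p : Regular m × PosMultiset) (a : ℕ) :
    (addMap hm p).1.count (m * a) = p.2.1.count a := by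
  rw [addMap, Multiset.count_add,
    Multiset.count_eq_zero.mpr fun h => p.1.2 _ h (Nat.dvd_mul_right m a), zero_add]
  exact Multiset.count_map_eq_count' _ _ (fun a b h => Nat.eq_of_mul_eq_mul_left (by omega) h) a

theorem addMap_bijective {m : ℕ} (hm : 2 ≤ m) : Function.Bijective (addMap hm) := by
  constructor
  · intro p q h
    refine Prod.ext (Subtype.ext (Subtype.ext ?_)) (Subtype.ext (Multiset.ext' fun a => ?_))
    · rw [← filter_not_dvd_addMap hm p, ← filter_not_dvd_addMap hm q, h]
    · rw [← count_addMap hm p, ← count_addMap hm q, h]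
  · intro M
    refine ⟨⟨⟨⟨M.1.filter fun x => ¬ m ∣ x, fun x hx => M.2 x (Multiset.mem_of_mem_filter hx)⟩,
      fun x hx => (Multiset.mem_filter.mp hx).2⟩,
      ⟨(M.1.filter fun x => m ∣ x).map (· / m), fun x hx => ?_⟩⟩, Subtype.ext ?_⟩
    · obtain ⟨a, ha, rfl⟩ := Multiset.mem_map.mp hx
      rw [Multiset.mem_filter] at ha
      exact Nat.div_pos (Nat.le_of_dvd (M.2 a ha.1) ha.2) (by omega)
    · change (M.1.filter fun x => ¬ m ∣ x) + ((M.1.filter fun x => m ∣ x).map (· / m)).map (m * ·) = _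
      rw [Multiset.map_map, Multiset.map_congr rfl (g := id), Multiset.map_id, add_comm,
        Multiset.filter_add_not]
      intro x hx
      exact Nat.mul_div_cancel' (Multiset.mem_filter.mp hx).2

theorem weight_addMap {m : ℕ} (hm : 2 ≤ m) {S : Finset ℕ} (hS : S ⊆ Finset.Icc 1 (m - 1))
    (p : Regular m × PosMultiset) :
    (addMap hm p).weight m S = p.1.1.weight m S + S.card * p.2.1.sum := by
  rw [addMap, weight, weight, Multiset.map_add, Multiset.sum_add, Multiset.map_map]
  simp only [Function.comp_def, schmidtCount_mul hm hS]
  rw [Multiset.sum_map_mul_left, Multiset.map_id']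

theorem hasResidues_addMap {m : ℕ} (hm : 2 ≤ m) {ρ : ℕ → ℕ} (p : Regular m × PosMultiset) :
    (addMap hm p).HasResidues m ρ ↔ p.1.1.HasResidues m ρ := by
  refine forall₂_congr fun j hj => ?_
  rw [Finset.mem_Ico] at hj
  have h : (p.2.1.map (m * ·)).countP (fun v => v % m = j) = 0 := by
    rw [Multiset.countP_eq_zero]
    intro x hx
    obtain ⟨a, _, rfl⟩ := Multiset.mem_map.mp hx
    simp only [Nat.mul_mod_right]
    omega
  rw [addMap, Multiset.countP_add, h, add_zero]

end PosMultiset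

/-! ### Cancelling a common factor of weight enumerators -/

section Cancellation

variable {X Y D : Type*}

theorem nonempty_equiv_shifted_fiber {PX : X → Prop} {PY : Y → Prop} {wX : X → ℕ} {wY : Y → ℕ}
    {n k : ℕ} (h : ∀ j, j + k = n →
      Nonempty ({x // PX x ∧ wX x = j} ≃ {y // PY y ∧ wY y = j})) :
    Nonempty ({x // PX x ∧ wX x + k = n} ≃ {y // PY y ∧ wY y + k = n}) := by
  by_cases hk : k ≤ n
  · obtain ⟨e⟩ := h (n - k) (Nat.sub_add_cancel hk)
    exact ⟨((Equiv.subtypeEquivRight fun x => and_congr_right fun _ => by omega).trans e).trans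
      (Equiv.subtypeEquivRight fun y => and_congr_right fun _ => by omega)⟩
  · have : IsEmpty {x // PX x ∧ wX x + k = n} := ⟨fun x => hk (x.2.2 ▸ Nat.le_add_left _ _)⟩
    have : IsEmpty {y // PY y ∧ wY y + k = n} := ⟨fun y => hk (y.2.2 ▸ Nat.le_add_left _ _)⟩
    exact ⟨Equiv.equivOfIsEmpty _ _⟩

theorem nonempty_prodFiber_equiv_sum (P : X → Prop) (w : X → ℕ) {wD : D → ℕ} {d₀ : D}
    (hd : wD d₀ = 0) (n : ℕ) :
    Nonempty (({x // P x ∧ w x = n} ⊕ Σ d : {d // d ≠ d₀}, {x // P x ∧ w x + wD d = n}) ≃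
      {p : X × D // P p.1 ∧ w p.1 + wD p.2 = n}) := by
  refine ⟨Equiv.ofBijective
    (Sum.elim (fun x => ⟨(x.1, d₀), x.2.1, by rw [hd, add_zero, x.2.2]⟩)
      (fun q => ⟨(q.2.1, q.1.1), q.2.2⟩)) ⟨?_, ?_⟩⟩
  · rintro (⟨x, hx⟩ | ⟨⟨d, hd1⟩, ⟨x, hx⟩⟩) (⟨y, hy⟩ | ⟨⟨d', hd2⟩, ⟨y, hy⟩⟩) h
    · simp only [Sum.elim_inl, Subtype.mk.injEq, Prod.mk.injEq, and_true] at h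
      subst h
      rfl
    · simp only [Sum.elim_inl, Sum.elim_inr, Subtype.mk.injEq, Prod.mk.injEq] at h
      exact absurd h.2.symm hd2
    · simp only [Sum.elim_inl, Sum.elim_inr, Subtype.mk.injEq, Prod.mk.injEq] at h
      exact absurd h.2 hd1
    · simp only [Sum.elim_inr, Subtype.mk.injEq, Prod.mk.injEq] at h
      obtain ⟨rfl, rfl⟩ := h
      rfl
  · rintro ⟨⟨x, d⟩, hx⟩
    by_cases h : d = d₀
    · subst h
      exact ⟨Sum.inl ⟨x, hx.1, by simpa [hd] using hx.2⟩, rfl⟩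
    · exact ⟨Sum.inr ⟨⟨d, h⟩, ⟨x, hx⟩⟩, rfl⟩

/-- A common factor with a unique element of weight zero can be cancelled from an equality of
weight enumerators with finite fibers. -/
theorem nonempty_fiber_equiv_of_prod {PX : X → Prop} {PY : Y → Prop} {wX : X → ℕ} {wY : Y → ℕ}
    {wD : D → ℕ} {d₀ : D} (hd : ∀ d, wD d = 0 ↔ d = d₀)
    (hfin : ∀ n, Finite {p : X × D // PX p.1 ∧ wX p.1 + wD p.2 = n})
    (e : ∀ n, Nonempty ({p : X × D // PX p.1 ∧ wX p.1 + wD p.2 = n} ≃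
      {p : Y × D // PY p.1 ∧ wY p.1 + wD p.2 = n})) (n : ℕ) :
    Nonempty ({x // PX x ∧ wX x = n} ≃ {y // PY y ∧ wY y = n}) := by
  induction n using Nat.strong_induction_on with
  | _ n ih =>
    have hd₀ : wD d₀ = 0 := (hd d₀).mpr rfl
    obtain ⟨eX⟩ := nonempty_prodFiber_equiv_sum PX wX hd₀ n
    obtain ⟨eY⟩ := nonempty_prodFiber_equiv_sum PY wY hd₀ n
    obtain ⟨eXY⟩ := e n
    have hrest : ∀ d : {d // d ≠ d₀}, Nonempty
        ({x // PX x ∧ wX x + wD d = n} ≃ {y // PY y ∧ wY y + wD d = n}) := fun d =>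
      -- For d ≠ d₀ the weight of d is positive, so only smaller weights of x and y occur.
      nonempty_equiv_shifted_fiber fun j hj => ih j (by
        have := (hd d.1).not.mpr d.2
        omega)
    have eR := Equiv.sigmaCongrRight fun d => (hrest d).some
    have hX := hfin n
    have hY := Finite.of_equiv _ eXY
    have hX' := Finite.of_equiv _ eX.symm
    have hY' := Finite.of_equiv _ eY.symm
    have hX1 := hX'.sum_left
    have hX2 := hX'.sum_right
    have hY1 := hY'.sum_left
    have hY2 := hY'.sum_right
    have hcard := Nat.card_congr ((eX.trans eXY).trans eY.symm)
    rw [Nat.card_sum, Nat.card_sum, Nat.card_congr eR] at hcard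
    exact Finite.card_eq.mp (Nat.add_right_cancel hcard)

end Cancellation

/-! ### Flat versus regular multisets -/

namespace PosMultiset

theorem sum_le_mul_weight {m : ℕ} (hm : 2 ≤ m) {S : Finset ℕ} (hS : S ⊆ Finset.Icc 1 (m - 1))
    (h1S : 1 ∈ S) (M : PosMultiset) : M.1.sum ≤ m * M.weight m S := by
  rw [weight, ← Multiset.sum_map_mul_left]
  conv_lhs => rw [← Multiset.map_id' M.1]
  exact Multiset.sum_map_le_sum_map _ _ fun v _ => le_mul_schmidtCount hm hS h1S v

theorem finite_weight_fiber {m : ℕ} (hm : 2 ≤ m) {S : Finset ℕ} (hS : S ⊆ Finset.Icc 1 (m - 1))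
    (h1S : 1 ∈ S) (P : PosMultiset → Prop) (n : ℕ) :
    Finite {M : PosMultiset // P M ∧ M.weight m S = n} := by
  refine Finite.of_injective (β := Σ k : Fin (m * n + 1), (k : ℕ).Partition)
    (fun M => ⟨⟨M.1.1.sum, Nat.lt_succ_of_le ((sum_le_mul_weight hm hS h1S M.1).trans_eq
      (congrArg (m * ·) M.2.2))⟩,
      ⟨M.1.1, fun {_} hx => M.1.2 _ hx, rfl⟩⟩) ?_
  intro M M' h
  refine Subtype.ext (Subtype.ext ?_)
  exact congrArg (fun q : Σ k : Fin (m * n + 1), (k : ℕ).Partition => q.2.parts) h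

/-- Both products with `PosMultiset` parametrize the same multisets N, one of them through
conjugation. The common factor cancels because only the empty multiset has weight zero in it. -/
theorem flat_fiber_equiv_regular_fiber {m : ℕ} (hm : 2 ≤ m) {S : Finset ℕ}
    (hS : S ⊆ Finset.Icc 1 (m - 1)) (h1S : 1 ∈ S) (ρ : ℕ → ℕ) (n : ℕ) :
    Nonempty ({R : Flat m // (conj R.1).HasResidues m ρ ∧ (conj R.1).weight m S = n} ≃
      {Y : Regular m // Y.1.HasResidues m ρ ∧ Y.1.weight m S = n}) := by
  have hcard : S.card ≠ 0 := Finset.card_ne_zero.mpr ⟨1, h1S⟩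
  have e1 : ∀ n, {p : Flat m × PosMultiset // (conj p.1.1).HasResidues m ρ ∧
      (conj p.1.1).weight m S + S.card * p.2.1.sum = n} ≃
      {N : PosMultiset // N.HasResidues m ρ ∧ N.weight m S = n} := fun n =>
    ((Equiv.ofBijective _ (addNsmul_bijective hm)).trans conj).subtypeEquiv fun p => by
      simp only [Equiv.trans_apply, Equiv.ofBijective_apply, weight_conj_addNsmul hm hS,
        hasResidues_conj_addNsmul]
  have e2 : ∀ n, {p : Regular m × PosMultiset // p.1.1.HasResidues m ρ ∧
      p.1.1.weight m S + S.card * p.2.1.sum = n} ≃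
      {N : PosMultiset // N.HasResidues m ρ ∧ N.weight m S = n} := fun n =>
    (Equiv.ofBijective _ (addMap_bijective hm)).subtypeEquiv fun p => by
      simp only [Equiv.ofBijective_apply, weight_addMap hm hS, hasResidues_addMap]
  refine nonempty_fiber_equiv_of_prod (PX := fun R : Flat m => (conj R.1).HasResidues m ρ)
    (PY := fun Y : Regular m => Y.1.HasResidues m ρ)
    (wD := fun Q : PosMultiset => S.card * Q.1.sum) (d₀ := ⟨0, by simp⟩) (fun Q => ?_) (fun n => ?_)
    (fun n => ⟨(e1 n).trans (e2 n).symm⟩) n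
  · rw [Nat.mul_eq_zero, or_iff_right hcard, Multiset.sum_eq_zero_iff, Subtype.ext_iff]
    refine ⟨fun h => Multiset.eq_zero_of_forall_notMem fun x hx => ?_, fun h => ?_⟩
    · exact (Q.2 x hx).ne' (h x hx)
    · rw [h]
      simp
  · have := finite_weight_fiber hm hS h1S (fun N => N.HasResidues m ρ) n
    exact Finite.of_equiv _ (e1 n).symm

theorem flat_prod_fiber_equiv_regular_prod_fiber {m : ℕ} (hm : 2 ≤ m) {S : Finset ℕ}
    (hS : S ⊆ Finset.Icc 1 (m - 1)) (h1S : 1 ∈ S) (ρ : ℕ → ℕ) (n : ℕ) (d : PosMultiset) :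
    Nonempty ({M : PosMultiset // (conj M).HasResidues m ρ ∧ (conj M).weight m S = n ∧
        ∀ a, M.1.count a / m = d.1.count a} ≃
      {N : PosMultiset // N.HasResidues m ρ ∧ N.weight m S = n ∧
        ∀ a, 0 < a → N.1.count (m * a) = d.1.count a}) := by
  have key : ∀ {X : Type} (P : X → Prop) (w : X → ℕ),
      Nonempty ({p : X × PosMultiset // P p.1 ∧ w p.1 + S.card * p.2.1.sum = n ∧ p.2 = d} ≃
        {x // P x ∧ w x + S.card * d.1.sum = n}) := fun {X} P w =>
    ⟨{ toFun := fun p => ⟨p.1.1, p.2.1, by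
         obtain ⟨⟨x, d'⟩, _, h, rfl⟩ := p
         exact h⟩
       invFun := fun x => ⟨(x.1, d), x.2.1, x.2.2, rfl⟩
       left_inv := fun p => Subtype.ext (Prod.ext rfl p.2.2.2.symm)
       right_inv := fun _ => rfl }⟩
  obtain ⟨k1⟩ := key (fun R : Flat m => (conj R.1).HasResidues m ρ)
    fun R => (conj R.1).weight m S
  obtain ⟨k2⟩ := key (fun Y : Regular m => Y.1.HasResidues m ρ) fun Y => Y.1.weight m S
  obtain ⟨k⟩ := nonempty_equiv_shifted_fiber (n := n) (k := S.card * d.1.sum)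
    fun j _ => flat_fiber_equiv_regular_fiber hm hS h1S ρ j
  have e1 := (Equiv.ofBijective _ (addNsmul_bijective hm)).subtypeEquiv
    (p := fun p : Flat m × PosMultiset => (conj p.1.1).HasResidues m ρ ∧
      (conj p.1.1).weight m S + S.card * p.2.1.sum = n ∧ p.2 = d)
    (q := fun M => (conj M).HasResidues m ρ ∧ (conj M).weight m S = n ∧
        ∀ a, M.1.count a / m = d.1.count a) fun p => by
      simp only [Equiv.ofBijective_apply, weight_conj_addNsmul hm hS, hasResidues_conj_addNsmul,
        count_addNsmul_div, Subtype.ext_iff, Multiset.ext]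
  have e2 := (Equiv.ofBijective _ (addMap_bijective hm)).subtypeEquiv
    (p := fun p : Regular m × PosMultiset => p.1.1.HasResidues m ρ ∧
      p.1.1.weight m S + S.card * p.2.1.sum = n ∧ p.2 = d)
    (q := fun N => N.HasResidues m ρ ∧ N.weight m S = n ∧
        ∀ a, 0 < a → N.1.count (m * a) = d.1.count a) fun p => by
      simp only [Equiv.ofBijective_apply, weight_addMap hm hS, hasResidues_addMap,
        count_addMap, Subtype.ext_iff, Multiset.ext]
      refine and_congr_right fun _ => and_congr_right fun _ => ⟨fun h a _ => h a, fun h a => ?_⟩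
      rcases Nat.eq_zero_or_pos a with rfl | ha
      · rw [Multiset.count_eq_zero.mpr fun h0 => (p.2.2 0 h0).false,
          Multiset.count_eq_zero.mpr fun h0 => (d.2 0 h0).false]
      · exact h a ha
  exact ⟨((e1.symm.trans k1).trans k).trans (k2.symm.trans e2)⟩

end PosMultiset

/-! ### Colors and residues -/

theorem List.getD_le_iff_lt_countP {l : List ℕ} (hl : l.Pairwise (· < ·)) {r m : ℕ} (hr : r < m)
    (k : ℕ) : l.getD k m ≤ r ↔ k < l.countP (· ≤ r) := by
  induction l generalizing k with
  | nil => simpa using hr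
  | cons a l ih =>
    rw [List.pairwise_cons] at hl
    by_cases ha : a ≤ r
    · rw [List.countP_cons_of_pos (by simpa using ha)]
      cases k with
      | zero => simpa using ha
      | succ k => rw [List.getD_cons_succ, ih hl.2, Nat.add_lt_add_iff_right]
    · have h0 : l.countP (· ≤ r) = 0 := by
        rw [List.countP_eq_zero]
        intro x hx
        have := hl.1 x hx
        simp only [decide_eq_true_eq]
        omega
      rw [List.countP_cons_of_neg (by simpa using ha)]
      cases k with
      | zero =>
        rw [h0, List.getD_cons_zero]
        omega
      | succ k =>
        rw [List.getD_cons_succ, ih hl.2, h0]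
        omega

section Color

variable {m : ℕ} {S : Finset ℕ}

theorem colorBound_le_iff (hS : S ⊆ Finset.Icc 1 (m - 1)) {c k : ℕ} (hc : c < m) :
    colorBound m S (k + 1) ≤ c ↔ k < schmidtCount m S c := by
  rw [colorBound, add_tsub_cancel_right,
    List.getD_le_iff_lt_countP (Finset.sortedLT_sort S).pairwise hc, schmidtCount_eq_card hS hc]
  have : (S.sort (fun a b => a ≤ b)).countP (· ≤ c) = (S.filter (· ≤ c)).card := by
    rw [← Multiset.coe_countP, Finset.sort_eq, Multiset.countP_eq_card_filter]
    rfl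
  rw [this]

theorem colorBound_mem_Icc (hm : 2 ≤ m) (hS : S ⊆ Finset.Icc 1 (m - 1)) (k : ℕ) :
    colorBound m S k ∈ Finset.Icc 1 m := by
  rw [colorBound, Finset.mem_Icc]
  by_cases h : k - 1 < (S.sort (fun a b => a ≤ b)).length
  · rw [List.getD_eq_getElem _ _ h]
    have := Finset.mem_Icc.mp (hS ((Finset.mem_sort _).mp (List.getElem_mem h)))
    omega
  · rw [List.getD_eq_default _ _ (not_lt.mp h)]
    omega

theorem schmidtCount_pos (hm : 2 ≤ m) (hS : S ⊆ Finset.Icc 1 (m - 1)) (h1S : 1 ∈ S) {v : ℕ}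
    (hv : 0 < v) : 0 < schmidtCount m S v :=
  Nat.pos_of_ne_zero fun h => by
    have := le_mul_schmidtCount hm hS h1S v
    rw [h, mul_zero] at this
    omega

theorem schmidtCount_le_card (hS : S ⊆ Finset.Icc 1 (m - 1)) {c : ℕ} (hc : c < m) :
    schmidtCount m S c ≤ S.card := by
  rw [schmidtCount_eq_card hS hc]
  exact Finset.card_filter_le _ _

/-- The color c lies in the k-th interval exactly when k elements of S are at most c, so c
determines k = `schmidtCount m S c`. -/
theorem allowedColor_iff (hm : 2 ≤ m) (hS : S ⊆ Finset.Icc 1 (m - 1)) (h1S : 1 ∈ S) {a c : ℕ} :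
    AllowedColor m S a c ↔ 1 ≤ c ∧ c < m ∧ a ≡ schmidtCount m S c [MOD S.card] := by
  constructor
  · rintro ⟨k, hk, hak, hc⟩
    rw [Finset.mem_Icc] at hk
    rw [Finset.mem_Ico] at hc
    have h1 := Finset.mem_Icc.mp (colorBound_mem_Icc hm hS k)
    have h2 := Finset.mem_Icc.mp (colorBound_mem_Icc hm hS (k + 1))
    have hcm : c < m := by omega
    refine ⟨by omega, hcm, ?_⟩
    have h3 := (colorBound_le_iff hS (k := k) hcm).not.mp (by omega)
    have h4 := (colorBound_le_iff hS (k := k - 1) hcm).mp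
      (by rw [Nat.sub_add_cancel hk.1]; exact hc.1)
    obtain rfl : k = schmidtCount m S c := by omega
    exact hak
  · rintro ⟨hc, hcm, ha⟩
    have hpos := schmidtCount_pos hm hS h1S (v := c) (by omega)
    refine ⟨schmidtCount m S c,
      Finset.mem_Icc.mpr ⟨hpos, schmidtCount_le_card hS hcm⟩, ha, Finset.mem_Ico.mpr ⟨?_, ?_⟩⟩
    · rw [← Nat.sub_add_cancel hpos, colorBound_le_iff hS hcm]
      omega
    · rw [← not_le, colorBound_le_iff hS hcm]
      exact lt_irrefl _

/-- The colored part of size `schmidtCount m S v` whose color is the residue of `v` modulo `m`,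
the residue being taken in `{1, ..., m}`. -/
def colorPart (m : ℕ) (S : Finset ℕ) (v : ℕ) : ℕ × ℕ :=
  (schmidtCount m S v, if m ∣ v then m else v % m)

theorem colorPart_mul (hm : 2 ≤ m) (hS : S ⊆ Finset.Icc 1 (m - 1)) (a : ℕ) :
    colorPart m S (m * a) = (S.card * a, m) := by
  rw [colorPart, schmidtCount_mul hm hS, if_pos (Nat.dvd_mul_right m a)]

theorem colorPart_snd_eq_iff {j : ℕ} (hj : j ∈ Finset.Ico 1 m) (v : ℕ) :
    (colorPart m S v).2 = j ↔ v % m = j := by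
  rw [Finset.mem_Ico] at hj
  simp only [colorPart]
  split_ifs with h
  · rw [Nat.mod_eq_zero_of_dvd h]
    omega
  · rfl

theorem schmidtCount_eq_div_add_mod (hm : 2 ≤ m) (hS : S ⊆ Finset.Icc 1 (m - 1)) (v : ℕ) :
    schmidtCount m S v = S.card * (v / m) + schmidtCount m S (v % m) := by
  rw [← schmidtCount_mul_add hm hS, Nat.div_add_mod]

/-- The color gives v % m, with m standing for 0; the size then gives v / m. -/
theorem colorPart_injective (hm : 2 ≤ m) (hS : S ⊆ Finset.Icc 1 (m - 1)) (h1S : 1 ∈ S) :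
    Function.Injective (colorPart m S) := by
  intro v w h
  have h1 := congrArg Prod.fst h
  have h2 := congrArg Prod.snd h
  simp only [colorPart] at h1 h2
  have hv := Nat.mod_lt v (show 0 < m by omega)
  have hw := Nat.mod_lt w (show 0 < m by omega)
  have hmod : v % m = w % m := by
    simp only [Nat.dvd_iff_mod_eq_zero] at h2
    split_ifs at h2 <;> omega
  rw [schmidtCount_eq_div_add_mod hm hS v, schmidtCount_eq_div_add_mod hm hS w, hmod] at h1
  have hdiv : v / m = w / m :=
    Nat.eq_of_mul_eq_mul_left (Finset.card_pos.mpr ⟨1, h1S⟩) (Nat.add_right_cancel h1)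
  rw [← Nat.div_add_mod v m, ← Nat.div_add_mod w m, hmod, hdiv]

theorem allowedColor_colorPart (hm : 2 ≤ m) (hS : S ⊆ Finset.Icc 1 (m - 1)) (h1S : 1 ∈ S) {v : ℕ}
    (hv : ¬ m ∣ v) : AllowedColor m S (colorPart m S v).1 (colorPart m S v).2 := by
  rw [allowedColor_iff hm hS h1S]
  simp only [colorPart, if_neg hv]
  refine ⟨Nat.pos_of_ne_zero fun h => hv (Nat.dvd_of_mod_eq_zero h), Nat.mod_lt _ (by omega), ?_⟩
  rw [schmidtCount_eq_div_add_mod hm hS v, Nat.ModEq, Nat.mul_add_mod]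

theorem exists_colorPart_eq (hm : 2 ≤ m) (hS : S ⊆ Finset.Icc 1 (m - 1)) (h1S : 1 ∈ S) {a c : ℕ}
    (ha : 0 < a) (h : AllowedColor m S a c) : ∃ v, 0 < v ∧ colorPart m S v = (a, c) := by
  obtain ⟨hc, hcm, hac⟩ := (allowedColor_iff hm hS h1S).mp h
  have hle := schmidtCount_le_card hS hcm
  have hpos := schmidtCount_pos hm hS h1S (v := c) (by omega)
  have hca : schmidtCount m S c ≤ a := by
    by_contra hlt
    -- Otherwise i would divide a positive difference smaller than `schmidtCount m S c` ≤ i.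
    have hd := (Nat.modEq_iff_dvd' (by omega)).mp hac
    have := Nat.le_of_dvd (by omega) hd
    omega
  obtain ⟨q, hq⟩ := (Nat.modEq_iff_dvd' hca).mp hac.symm
  refine ⟨m * q + c, by omega, Prod.ext ?_ ?_⟩
  · simp only [colorPart]
    rw [schmidtCount_mul_add hm hS]
    omega
  · rw [colorPart_snd_eq_iff (Finset.mem_Ico.mpr ⟨hc, hcm⟩), Nat.mul_add_mod,
      Nat.mod_eq_of_lt hcm]

/-- Color the parts of a multiset by their residues. -/
def PosMultiset.colored (hm : 2 ≤ m) (hS : S ⊆ Finset.Icc 1 (m - 1)) (h1S : 1 ∈ S) {n : ℕ}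
    (N : PosMultiset) (hN : N.weight m S = n) : ColoredPartition n where
  parts := N.1.map (colorPart m S)
  parts_pos x hx := by
    obtain ⟨v, hv, rfl⟩ := Multiset.mem_map.mp hx
    exact schmidtCount_pos hm hS h1S (N.2 v hv)
  parts_sum := by
    rw [← hN, Multiset.map_map]
    rfl

end Color

theorem ColoredPartition.parts_injective {n : ℕ} :
    Function.Injective (ColoredPartition.parts : ColoredPartition n → _) := by
  rintro ⟨⟩ ⟨⟩ rfl
  rfl

/-! ### Prescribed multiplicities and the final bijection -/

section Main

variable {m : ℕ} {S : Finset ℕ} {t : ℕ} {α : Fin t → ℕ}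

/-- The multiset in which each `α r` has multiplicity `e r`. -/
def multisetOfMultiplicities (α e : Fin t → ℕ) (hαpos : ∀ r, 0 < α r) : PosMultiset :=
  ⟨∑ r, Multiset.replicate (e r) (α r), fun x hx => by
    obtain ⟨r, _, hr⟩ := Multiset.mem_sum.mp hx
    rw [Multiset.eq_of_mem_replicate hr]
    exact hαpos r⟩

theorem count_multisetOfMultiplicities (hα : Function.Injective α) (e : Fin t → ℕ)
    (hαpos : ∀ r, 0 < α r) (r : Fin t) :
    (multisetOfMultiplicities α e hαpos).1.count (α r) = e r := by
  simp [multisetOfMultiplicities, Multiset.count_sum', Multiset.count_replicate, hα.eq_iff]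

theorem count_multisetOfMultiplicities_eq_zero (e : Fin t → ℕ) (hαpos : ∀ r, 0 < α r) {a : ℕ}
    (ha : ¬ ∃ r, α r = a) : (multisetOfMultiplicities α e hαpos).1.count a = 0 := by
  rw [not_exists] at ha
  simp [multisetOfMultiplicities, Multiset.count_sum', Multiset.count_replicate, ha]

/-- A multiplicity is at least m exactly when its quotient by m is positive, so the quotients alone
also record which integers are the α r. -/
theorem forall_count_div_eq_iff (hm : 2 ≤ m) (hα : Function.Injective α) (hαpos : ∀ r, 0 < α r)
    {p : Fin t → ℕ} (hp : ∀ r, m ≤ p r) (M : Multiset ℕ) :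
    (∀ a, M.count a / m = (multisetOfMultiplicities α (fun r => p r / m) hαpos).1.count a) ↔
      (∀ a, m ≤ M.count a ↔ ∃ r, α r = a) ∧ ∀ r, M.count (α r) / m = p r / m := by
  constructor
  · intro h
    have h2 : ∀ r, M.count (α r) / m = p r / m := fun r => by
      rw [h, count_multisetOfMultiplicities hα]
    refine ⟨fun a => ⟨fun ha => ?_, ?_⟩, h2⟩
    · by_contra hr
      have := Nat.div_pos ha (by omega)
      rw [h, count_multisetOfMultiplicities_eq_zero _ _ hr] at this
      exact this.false
    · rintro ⟨r, rfl⟩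
      have := Nat.div_pos (hp r) (by omega)
      rw [← h2 r, Nat.div_pos_iff] at this
      exact this.2
  · rintro ⟨h1, h2⟩ a
    by_cases ha : ∃ r, α r = a
    · obtain ⟨r, rfl⟩ := ha
      rw [h2, count_multisetOfMultiplicities hα]
    · rw [count_multisetOfMultiplicities_eq_zero _ _ ha,
        Nat.div_eq_of_lt (not_le.mp ((h1 a).not.mpr ha))]

theorem colored_conditions_iff (hm : 2 ≤ m) (hS : S ⊆ Finset.Icc 1 (m - 1)) (h1S : 1 ∈ S)
    (ρ : ℕ → ℕ) (hα : Function.Injective α) (hαpos : ∀ r, 0 < α r) (e : Fin t → ℕ) {n : ℕ}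
    (N : PosMultiset) (hN : N.weight m S = n) :
    ((∀ x ∈ (N.colored hm hS h1S hN).parts,
        AllowedColor m S x.1 x.2 ∨ (x.2 = m ∧ ∃ r, x.1 = S.card * α r)) ∧
      (∀ j ∈ Finset.Ico 1 m, (N.colored hm hS h1S hN).colorCount j = ρ j) ∧
      (∀ r, (N.colored hm hS h1S hN).parts.count (S.card * α r, m) = e r)) ↔
    N.HasResidues m ρ ∧
      ∀ a, 0 < a → N.1.count (m * a) = (multisetOfMultiplicities α e hαpos).1.count a := by
  have hcard : 0 < S.card := Finset.card_pos.mpr ⟨1, h1S⟩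
  have hcount : ∀ a, (N.colored hm hS h1S hN).parts.count (S.card * a, m) = N.1.count (m * a) := by
    intro a
    rw [← colorPart_mul hm hS]
    exact Multiset.count_map_eq_count' _ _ (colorPart_injective hm hS h1S) _
  have hres : (∀ j ∈ Finset.Ico 1 m, (N.colored hm hS h1S hN).colorCount j = ρ j) ↔
      N.HasResidues m ρ := by
    refine forall₂_congr fun j hj => ?_
    rw [ColoredPartition.colorCount, colored, Multiset.countP_map,
      ← Multiset.countP_eq_card_filter]
    simp only [colorPart_snd_eq_iff hj]
  rw [hres]
  simp only [hcount]
  constructor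
  · rintro ⟨h1, h2, h3⟩
    refine ⟨h2, fun a _ => ?_⟩
    by_cases hr : ∃ r, α r = a
    · obtain ⟨r, rfl⟩ := hr
      rw [h3, count_multisetOfMultiplicities hα]
    · rw [count_multisetOfMultiplicities_eq_zero _ _ hr, Multiset.count_eq_zero]
      intro hmem
      rcases h1 _ (Multiset.mem_map_of_mem (colorPart m S) hmem) with h | ⟨_, r, h⟩
      · rw [colorPart_mul hm hS, allowedColor_iff hm hS h1S] at h
        exact h.2.1.false
      · rw [colorPart_mul hm hS] at h
        exact hr ⟨r, (Nat.eq_of_mul_eq_mul_left hcard h).symm⟩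
  · rintro ⟨h1, h2⟩
    refine ⟨fun x hx => ?_, h1, fun r => ?_⟩
    · obtain ⟨v, hv, rfl⟩ := Multiset.mem_map.mp hx
      by_cases hd : m ∣ v
      · obtain ⟨a, rfl⟩ := hd
        have ha : 0 < a := Nat.pos_of_mul_pos_left (N.2 _ hv)
        refine Or.inr ?_
        rw [colorPart_mul hm hS]
        refine ⟨rfl, ?_⟩
        by_contra hr
        have h0 := h2 a ha
        rw [count_multisetOfMultiplicities_eq_zero _ _ fun ⟨r, h⟩ => hr ⟨r, by rw [h]⟩,
          Multiset.count_eq_zero] at h0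
        exact h0 hv
      · exact Or.inl (allowedColor_colorPart hm hS h1S hd)
    · rw [h2 _ (hαpos r), count_multisetOfMultiplicities hα]

theorem exists_colored_eq (hm : 2 ≤ m) (hS : S ⊆ Finset.Icc 1 (m - 1)) (h1S : 1 ∈ S)
    (hαpos : ∀ r, 0 < α r) {n : ℕ} (Q : ColoredPartition n)
    (hQ : ∀ x ∈ Q.parts, AllowedColor m S x.1 x.2 ∨ (x.2 = m ∧ ∃ r, x.1 = S.card * α r)) :
    ∃ (N : PosMultiset) (hN : N.weight m S = n), N.colored hm hS h1S hN = Q := by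
  have hex : ∀ x : ℕ × ℕ, ∃ v, x ∈ Q.parts → 0 < v ∧ colorPart m S v = x := by
    intro x
    by_cases hx : x ∈ Q.parts
    · rcases hQ x hx with h | ⟨h1, r, h2⟩
      · obtain ⟨v, hv⟩ := exists_colorPart_eq hm hS h1S (Q.parts_pos x hx) h
        exact ⟨v, fun _ => hv⟩
      · refine ⟨m * α r, fun _ => ⟨Nat.mul_pos (by omega) (hαpos r), ?_⟩⟩
        rw [colorPart_mul hm hS, ← h2, ← h1]
    -- Junk value, so that a preimage can be chosen for every pair.
    · exact ⟨0, fun h => absurd h hx⟩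
  choose f hf using hex
  have hmap : (Q.parts.map f).map (colorPart m S) = Q.parts := by
    rw [Multiset.map_map]
    conv_rhs => rw [← Multiset.map_id Q.parts]
    exact Multiset.map_congr rfl fun x hx => (hf x hx).2
  refine ⟨⟨Q.parts.map f, fun v hv => ?_⟩, ?_, ColoredPartition.parts_injective hmap⟩
  · obtain ⟨x, hx, rfl⟩ := Multiset.mem_map.mp hv
    exact (hf x hx).1
  · refine Eq.trans ?_ Q.parts_sum
    conv_rhs => rw [← hmap, Multiset.map_map]
    rfl

end Main

theorem theorem6 (m : ℕ) (hm : 2 ≤ m) (S : Finset ℕ) (hS : S ⊆ Finset.Icc 1 (m - 1))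
    (h1S : 1 ∈ S) (n : ℕ) (hn : 1 ≤ n) (ρ : ℕ → ℕ)
    (t : ℕ) (α : Fin t → ℕ) (hα : Function.Injective α) (hαpos : ∀ r, 0 < α r)
    (p : Fin t → ℕ) (hp : ∀ r, m ≤ p r) :
    Nonempty
      ({P : AllPartitions //
          P.schmidtWeight m S = n ∧
          (∀ j ∈ Finset.Ico 1 m, P.altSum m j = (ρ j : ℤ)) ∧
          (∀ a : ℕ, m ≤ P.2.parts.count a ↔ ∃ r, α r = a) ∧
          (∀ r, P.2.parts.count (α r) / m = p r / m)} ≃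
        {Q : ColoredPartition n //
          (∀ x ∈ Q.parts, AllowedColor m S x.1 x.2 ∨ (x.2 = m ∧ ∃ r, x.1 = S.card * α r)) ∧
          (∀ j ∈ Finset.Ico 1 m, Q.colorCount j = ρ j) ∧
          (∀ r, Q.parts.count (S.card * α r, m) = p r / m)}) := by
  obtain ⟨E⟩ := PosMultiset.flat_prod_fiber_equiv_regular_prod_fiber hm hS h1S ρ n
    (multisetOfMultiplicities α (fun r => p r / m) hαpos)
  refine ⟨((AllPartitions.equivPosMultiset.subtypeEquiv fun P => ?_).trans E).trans
    (Equiv.ofBijective (fun N => ⟨N.1.colored hm hS h1S N.2.2.1,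
      (colored_conditions_iff hm hS h1S ρ hα hαpos _ N.1 N.2.2.1).mpr ⟨N.2.1, N.2.2.2⟩⟩)
      ⟨fun N N' h => ?_, fun Q => ?_⟩)⟩
  · rw [forall_count_div_eq_iff hm hα hαpos hp, AllPartitions.schmidtWeight_eq, and_left_comm]
    refine and_congr (forall₂_congr fun j hj => ?_) Iff.rfl
    rw [AllPartitions.altSum_eq hm hj, Nat.cast_inj]
  · have h' := congrArg (fun Q => Q.1.parts) h
    exact Subtype.ext (Subtype.ext
      (Multiset.map_injective (colorPart_injective hm hS h1S) h'))
  · obtain ⟨N, hN, hNQ⟩ := exists_colored_eq hm hS h1S hαpos Q.1 Q.2.1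
    have h := Q.2
    rw [← hNQ, colored_conditions_iff hm hS h1S ρ hα hαpos] at h
    exact ⟨⟨N, h.1, hN, h.2⟩, Subtype.ext hNQ⟩
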